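/- Let $\mathcal H$ be a complex Hilbert space, $H$ a (possibly unbounded) self-adjoint operator in $\mathcal H$ with spectral measure $E$, write $E(\lambda)=E((-\infty,\lambda))$, and let $P_{ac}=P_{ac}(H)$ be the orthogonal projection onto the absolutely continuous subspace of $H$. Let $\mathcal X$ be a complex normed space that is continuously, injectively and densely embedded in $\mathcal H$. Let $\mathcal X^*$ be its dual, realized as the space of bounded conjugate-linear functionals on $\mathcal X$ with the operator norm, let $\langle\cdot,\cdot\rangle$ be the $\mathcal X^*,\mathcal X$ pairing, and embed $\mathcal H$ into $\mathcal X^*$ by $\langle h,g\rangle=(h,g)_{\mathcal H}$, the scalar product being linear in its first argument. Let $J\subseteq\mathbb R$ be open and assume: (i) for every $\lambda\in J$ there is a bounded operator $A(\lambda):\mathcal X\to\mathcal X^*$ such that $\langle A(\lambda)f,g\rangle=\frac{d}{d\lambda}(E(\lambda)P_{ac}f,g)_{\mathcal H}$ for all $f,g\in\mathcal X$, and $\lambda\mapsto\langle A(\lambda)f,g\rangle$ is continuous on $J$ for all $f,g\in\mathcal X$; (ii) $\sigma$ is a continuous real-valued function on $J$; there is a finite set $\mathcal N\subseteq J$ such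 that the real-valued function $a$ is $C^1$ on $J\setminus\mathcal N$ with $a'(\lambda)>0$ there, and $a$ is injective on $J\setminus\mathcal N$. Let $\phi\in\mathcal X$ be such that $P_{ac}E(J)\phi$ belongs to the domain of $\sigma(H)$ (that is, $\int_J|\sigma|^2\,d(E P_{ac}\phi,P_{ac}\phi)<\infty$), so that $\sigma(H)e^{ita(H)}P_{ac}E(J)\phi\in\mathcal H$ is defined for all $t\in\mathbb R$. Then the following identities hold in $[0,\infty]$. (1) For every $\psi\in\mathcal X$, $$\big\|(\sigma(H)e^{ita(H)}P_{ac}E(J)\phi,\psi)_{\mathcal H}\big\|_{L^2(\mathbb R_t)}=\sqrt{2\pi}\,\Big\|\frac{\sigma(\lambda)}{a'(\lambda)^{1/2}}\langle A(\lambda)\phi,\psi\rangle\Big\|_{L^2(J_\lambda)}.$$ (2) If $\mathcal X$ is a Hilbert space, i.e. it is complete and its norm comes from an inner product, then $$\big\|\sigma(H)e^{ita(H)}P_{ac}E(J)\phi\big\|_{L^2(\mathbb R_t,\mathcal X^*)}=\sqrt{2\pi}\,\Big\|\frac{\sigma(\lambda)}{a'(\lambda)^{1/2}}A(\lambda)\phi\Big\|_{L^2(J_\lambda,\mathcal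 X^*)}.$$ -/

import Mathlib

open MeasureTheory Set
open scoped ENNReal

noncomputable section

variable {ℋ : Type*} [NormedAddCommGroup ℋ] [InnerProductSpace ℂ ℋ] [CompleteSpace ℋ]

/-- A projection-valued measure (resolution of the identity) on the Borel sets of the real line,
with values in the orthogonal projections of the Hilbert space `ℋ`. The values of `proj` on
sets that are not Borel are irrelevant. -/
structure ProjectionValuedMeasure (ℋ : Type*) [NormedAddCommGroup ℋ] [InnerProductSpace ℂ ℋ]
    [CompleteSpace ℋ] where
  /-- The projection `E(s)`. -/
  proj : Set ℝ → ℋ →L[ℂ] ℋ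
  isStarProjection_proj : ∀ s, MeasurableSet s → IsStarProjection (proj s)
  proj_univ : proj univ = 1
  proj_inter : ∀ s t, MeasurableSet s → MeasurableSet t → proj (s ∩ t) = proj s * proj t
  hasSum_proj_iUnion : ∀ s : ℕ → Set ℝ, (∀ n, MeasurableSet (s n)) →
    Pairwise (fun m n => Disjoint (s m) (s n)) →
    ∀ x, HasSum (fun n => proj (s n) x) (proj (⋃ n, s n) x)

namespace ProjectionValuedMeasure

variable (E : ProjectionValuedMeasure ℋ)

theorem proj_empty : E.proj ∅ = 0 := by
  ext x
  have h := E.hasSum_proj_iUnion (fun _ => ∅) (fun _ => MeasurableSet.empty)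
    (fun _ _ _ => by simp) x
  have h0 := h.summable.tendsto_atTop_zero
  simpa using tendsto_nhds_unique tendsto_const_nhds h0

theorem inner_proj_proj (x : ℋ) {s t : Set ℝ} (hs : MeasurableSet s) (ht : MeasurableSet t) :
    inner ℂ (E.proj s x) (E.proj t x) = ((‖E.proj (s ∩ t) x‖ ^ 2 : ℝ) : ℂ) := by
  have key : ∀ u, MeasurableSet u → ∀ y z : ℋ,
      inner ℂ (E.proj u y) z = inner ℂ y (E.proj u z) := by
    intro u hu y z
    have := (E.isStarProjection_proj u hu).isSelfAdjoint
    rw [ContinuousLinearMap.isSelfAdjoint_iff_isSymmetric] at this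
    exact this y z
  have hst := hs.inter ht
  have e1 : inner ℂ (E.proj s x) (E.proj t x) = inner ℂ x (E.proj (s ∩ t) x) := by
    rw [key s hs, E.proj_inter s t hs ht]; rfl
  have e2 : inner ℂ (E.proj (s ∩ t) x) (E.proj (s ∩ t) x) = inner ℂ x (E.proj (s ∩ t) x) := by
    rw [key _ hst]
    have := (E.isStarProjection_proj _ hst).isIdempotentElem
    exact congrArg (fun T : ℋ →L[ℂ] ℋ => inner ℂ x (T x)) this
  rw [e1, ← e2, inner_self_eq_norm_sq_to_K]
  norm_cast

theorem hasSum_norm_sq_proj_iUnion (x : ℋ) (s : ℕ → Set ℝ) (hs : ∀ n, MeasurableSet (s n))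
    (hd : Pairwise (fun m n => Disjoint (s m) (s n))) :
    HasSum (fun n => ‖E.proj (s n) x‖ ^ 2) (‖E.proj (⋃ n, s n) x‖ ^ 2) := by
  have h := E.hasSum_proj_iUnion s hs hd x
  have hU := MeasurableSet.iUnion hs
  have h2 := (Complex.reCLM.hasSum ((innerSL ℂ (E.proj (⋃ n, s n) x)).hasSum h))
  have e1 : ∀ n, inner ℂ (E.proj (⋃ n, s n) x) (E.proj (s n) x)
      = ((‖E.proj (s n) x‖ ^ 2 : ℝ) : ℂ) := by
    intro n
    rw [E.inner_proj_proj x hU (hs n), inter_eq_self_of_subset_right (subset_iUnion s n)]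
  have e2 := E.inner_proj_proj x hU hU
  rw [inter_self] at e2
  simpa [Function.comp_def, e1, e2, ← Complex.ofReal_pow] using h2

/-- The finite positive Borel measure `μ_x(s) = ‖E(s)x‖² = (E(s)x, x)`. -/
def measure (x : ℋ) : Measure ℝ :=
  Measure.ofMeasurable (fun s _ => ENNReal.ofReal (‖E.proj s x‖ ^ 2))
    (by simp [E.proj_empty])
    (by
      intro s hs hd
      have h := E.hasSum_norm_sq_proj_iUnion x s hs hd
      rw [← h.tsum_eq, ENNReal.ofReal_tsum_of_nonneg (fun n => by positivity) h.summable])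

theorem measure_apply (x : ℋ) {s : Set ℝ} (hs : MeasurableSet s) :
    E.measure x s = ENNReal.ofReal (‖E.proj s x‖ ^ 2) :=
  Measure.ofMeasurable_apply s hs

instance isFiniteMeasure_measure (x : ℋ) : IsFiniteMeasure (E.measure x) :=
  ⟨by rw [E.measure_apply x MeasurableSet.univ]; exact ENNReal.ofReal_lt_top⟩

theorem measureReal_apply (x : ℋ) {s : Set ℝ} (hs : MeasurableSet s) :
    (E.measure x).real s = ‖E.proj s x‖ ^ 2 := by
  rw [Measure.real, E.measure_apply x hs, ENNReal.toReal_ofReal (by positivity)]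

/-- The linear map `∑ c_s 1_s ↦ ∑ c_s E(s)x` on formal combinations of Borel sets. -/
def combProj (x : ℋ) : ({s : Set ℝ // MeasurableSet s} →₀ ℂ) →ₗ[ℂ] ℋ :=
  Finsupp.linearCombination ℂ (fun s => E.proj s.1 x)

/-- The realization of the formal combination `∑ c_s 1_s` as an element of `L²(μ_x)`. -/
def combIndicator (x : ℋ) :
    ({s : Set ℝ // MeasurableSet s} →₀ ℂ) →ₗ[ℂ] Lp ℂ 2 (E.measure x) :=
  Finsupp.linearCombination ℂ
    (fun s => indicatorConstLp 2 s.2 (measure_ne_top (E.measure x) s.1) (1 : ℂ))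

/-- The spectral integral `f ↦ ∫ f(λ) dE(λ)x` as a bounded map `L²(μ_x) → ℋ`: the continuous
extension of `∑ c_s 1_s ↦ ∑ c_s E(s)x`. -/
def integralL2 (x : ℋ) : Lp ℂ 2 (E.measure x) →L[ℂ] ℋ :=
  (E.combProj x).extendOfNorm (E.combIndicator x)

theorem norm_combProj (x : ℋ) (c : {s : Set ℝ // MeasurableSet s} →₀ ℂ) :
    ‖E.combProj x c‖ = ‖E.combIndicator x c‖ := by
  have h : inner ℂ (E.combProj x c) (E.combProj x c)
      = inner ℂ (E.combIndicator x c) (E.combIndicator x c) := by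
    simp only [combProj, combIndicator, Finsupp.linearCombination_apply, Finsupp.sum,
      sum_inner, inner_sum, inner_smul_left, inner_smul_right]
    refine Finset.sum_congr rfl fun s _ => congrArg (c s * ·) ?_
    refine Finset.sum_congr rfl fun t _ => congrArg (starRingEnd ℂ (c t) * ·) ?_
    rw [E.inner_proj_proj x t.2 s.2, L2.inner_indicatorConstLp_indicatorConstLp]
    rw [E.measureReal_apply x (t.2.inter s.2)]
    simp
  rw [inner_self_eq_norm_sq_to_K, inner_self_eq_norm_sq_to_K] at h
  have h' : ‖E.combProj x c‖ ^ 2 = ‖E.combIndicator x c‖ ^ 2 := by exact_mod_cast h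
  exact (sq_eq_sq₀ (norm_nonneg _) (norm_nonneg _)).1 h'

theorem denseRange_combIndicator (x : ℋ) : DenseRange (E.combIndicator x) := by
  intro f
  refine Lp.induction (p := 2) (by simp)
    (motive := fun f => f ∈ closure (range (E.combIndicator x))) ?_ ?_ ?_ f
  · intro c s hs hμ
    refine subset_closure ⟨Finsupp.single ⟨s, hs⟩ c, ?_⟩
    rw [Lp.simpleFunc.coe_indicatorConst]
    rw [combIndicator, Finsupp.linearCombination_single]
    rw [indicatorConstLp, indicatorConstLp, ← MemLp.toLp_const_smul]
    congr 1
    ext l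
    by_cases hl : l ∈ s <;> simp [hl]
  · intro f g hf hg _ hfm hgm
    have := (LinearMap.range (E.combIndicator x)).topologicalClosure.add_mem
      (x := hf.toLp f) (y := hg.toLp g) hfm hgm
    exact this
  · exact isClosed_closure

theorem integralL2_combIndicator (x : ℋ) (c : {s : Set ℝ // MeasurableSet s} →₀ ℂ) :
    E.integralL2 x (E.combIndicator x c) = E.combProj x c :=
  LinearMap.extendOfNorm_eq (E.denseRange_combIndicator x)
    ⟨1, fun c => by rw [one_mul, E.norm_combProj x c]⟩ c

theorem integralL2_indicator (x : ℋ) {s : Set ℝ} (hs : MeasurableSet s) :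
    E.integralL2 x (indicatorConstLp 2 hs (measure_ne_top (E.measure x) s) (1 : ℂ))
      = E.proj s x := by
  have := E.integralL2_combIndicator x (Finsupp.single ⟨s, hs⟩ 1)
  simpa [combIndicator, combProj] using this

theorem norm_integralL2 (x : ℋ) (f : Lp ℂ 2 (E.measure x)) : ‖E.integralL2 x f‖ = ‖f‖ := by
  refine (E.denseRange_combIndicator x).induction_on
    (p := fun f => ‖E.integralL2 x f‖ = ‖f‖) f ?_ ?_
  · exact isClosed_eq (by fun_prop) (by fun_prop)
  · intro c
    rw [E.integralL2_combIndicator, E.norm_combProj]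

/-- The domain of the operator `f(H) = ∫ f dE`: all `x` with `∫ |f|² dμ_x < ∞`. -/
def domain (f : ℝ → ℂ) : Set ℋ := {x | MemLp f 2 (E.measure x)}

open Classical in
/-- The vector `f(H)x = ∫ f(λ) dE(λ)x` for `x` in the domain of `f(H) = ∫ f dE`; the value outside
the domain is the irrelevant default `0`. -/
def apply (f : ℝ → ℂ) (x : ℋ) : ℋ :=
  if h : MemLp f 2 (E.measure x) then E.integralL2 x (h.toLp f) else 0

/-- `E` is the spectral measure of the (unbounded) operator `H`, that is, `H = ∫ λ dE(λ)`,
including equality of the domains. -/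
structure IsSpectralMeasureOf (E : ProjectionValuedMeasure ℋ) (H : ℋ →ₗ.[ℂ] ℋ) : Prop where
  domain_eq : (H.domain : Set ℋ) = E.domain (fun l => (l : ℂ))
  apply_eq : ∀ x : H.domain, H x = E.apply (fun l => (l : ℂ)) x

theorem measure_absolutelyContinuous_iff (x : ℋ) :
    E.measure x ≪ volume ↔ ∀ s, MeasurableSet s → volume s = 0 → E.proj s x = 0 := by
  constructor
  · intro h s hs h0
    have := h h0
    rw [E.measure_apply x hs, ENNReal.ofReal_eq_zero] at this
    have h2 : ‖E.proj s x‖ ^ 2 = 0 := le_antisymm this (by positivity)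
    simpa using h2
  · intro h
    refine Measure.AbsolutelyContinuous.mk fun s hs h0 => ?_
    rw [E.measure_apply x hs, h s hs h0]
    simp

/-- The absolutely continuous subspace: all `x` whose spectral measure `μ_x` is absolutely
continuous with respect to Lebesgue measure. -/
def acSubspace : Submodule ℂ ℋ where
  carrier := {x | E.measure x ≪ volume}
  add_mem' := by
    intro x y hx hy
    simp only [mem_ofPred_eq, measure_absolutelyContinuous_iff] at hx hy ⊢
    intro s hs h0
    rw [map_add, hx s hs h0, hy s hs h0, add_zero]
  zero_mem' := by
    simp only [mem_ofPred_eq, measure_absolutelyContinuous_iff]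
    intro s _ _
    exact map_zero _
  smul_mem' := by
    intro c x hx
    simp only [mem_ofPred_eq, measure_absolutelyContinuous_iff] at hx ⊢
    intro s hs h0
    rw [map_smul, hx s hs h0, smul_zero]

theorem isClosed_acSubspace : IsClosed (E.acSubspace : Set ℋ) := by
  have : (E.acSubspace : Set ℋ)
      = ⋂ (s : Set ℝ) (_ : MeasurableSet s) (_ : volume s = 0), {x | E.proj s x = 0} := by
    ext x
    simp only [mem_iInter, mem_ofPred_eq]
    exact E.measure_absolutelyContinuous_iff x
  rw [this]
  exact isClosed_iInter fun s => isClosed_iInter fun _ => isClosed_iInter fun _ =>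
    isClosed_eq (by fun_prop) continuous_const

instance completeSpace_acSubspace : CompleteSpace E.acSubspace :=
  E.isClosed_acSubspace.completeSpace_coe

/-- The orthogonal projection `P_ac` onto the absolutely continuous subspace. -/
def Pac : ℋ →L[ℂ] ℋ := E.acSubspace.starProjection

end ProjectionValuedMeasure

/-- The dual space `𝒳*`: bounded conjugate-linear functionals on `𝒳`, with the operator norm. With
conjugate-linear functionals the inclusion `ℋ ⊆ 𝒳*` is linear and the pairing `⟨u, g⟩ = u g` is
linear in `u` and conjugate-linear in `g`. -/
abbrev AntiDual (X : Type*) [NormedAddCommGroup X] [NormedSpace ℂ X] : Type _ :=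
  X →L⋆[ℂ] ℂ

/-- The canonical inclusion `ℋ ⊆ 𝒳*` induced by `ι : 𝒳 → ℋ`: the vector `h` acts as
`g ↦ (h, g)`, where the scalar product is linear in `h` and conjugate-linear in `g`. -/
def toAntiDual {X : Type*} [NormedAddCommGroup X] [NormedSpace ℂ X] (ι : X →L[ℂ] ℋ) (h : ℋ) :
    AntiDual X :=
  ((innerSL ℂ).flip h).comp ι

/-- The vector `σ(H) e^{it a(H)} P_ac(H) E(J) φ`, where `σ` and `a` matter only on `J` and are
extended by zero. -/
def spectralEvolution (E : ProjectionValuedMeasure ℋ) (J : Set ℝ) (σ a : ℝ → ℝ) (t : ℝ)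
    (φ : ℋ) : ℋ :=
  E.apply (fun l => ((J.indicator σ l : ℝ) : ℂ))
    (E.apply (fun l => Complex.exp (Complex.I * t * (J.indicator a l : ℝ)))
      (E.Pac (E.proj J φ)))

end

/-! ### Plancherel's identity in [0, ∞]. -/

section FourierL2

open FourierTransform SchwartzMap

/-! The complex measure `(E(·) P_ac φ, ψ)` is absolutely continuous, and by Lebesgue differentiation
its density on `J` is `⟨A(λ)φ, ψ⟩` almost everywhere. Hence `inner_spectralEvolution`: the matrix
element in (1) is `∫_J e^{ita(λ)} σ(λ) ⟨A(λ)φ, ψ⟩ dλ`. Off the null set `N`, the substitution `m =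
a(λ)` makes this a Fourier integral over `a(J \ N)`. Plancherel applies; the squared density carries
`1/a'²` and the Jacobian returns one `a'`, which leaves the weight `1/a'`. The identity must hold in
[0, ∞], so Plancherel is needed for functions that are only integrable (`eLpNorm_fourier`).

For (2), the squares of (1) are summed over an orthonormal set. `X` need not be separable, so a
countable set is extracted from the functionals `A(λ)φ` with `λ` in a countable dense subset of `J`
(`AntiDual.exists_countable_parseval`). By weak continuity of `A` and the integral formula, all
functionals in (2) vanish on the common kernel of these, so Parseval on that set computes their
norms, and Tonelli exchanges sum and integral. -/

theorem ae_eq_of_integral_schwartz_smul_eq {f g : ℝ → ℂ} (hf : LocallyIntegrable f)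
    (hg : LocallyIntegrable g) (h : ∀ u : 𝓢(ℝ, ℂ), ∫ x, u x • f x = ∫ x, u x • g x) :
    f =ᵐ[volume] g := by
  refine ae_eq_of_integral_contDiff_smul_eq hf hg fun v hv hvc => ?_
  have h₁ : HasCompactSupport (Complex.ofRealCLM ∘ v) := hvc.comp_left rfl
  have h₂ : ContDiff ℝ (↑(⊤ : ℕ∞)) (Complex.ofRealCLM ∘ v) := by fun_prop
  simpa using h (h₁.toSchwartzMap h₂)

theorem integral_fourier_smul_eq {f g : ℝ → ℂ} (hf : Integrable f) (hg : Integrable g) :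
    ∫ x, 𝓕 f x • g x = ∫ x, f x • 𝓕 g x := by
  simpa using! (VectorFourier.integral_fourierIntegral_smul_eq_flip (L := innerₗ ℝ)
    Real.continuous_fourierChar continuous_inner hf hg)

theorem continuous_fourier {h : ℝ → ℂ} (hh : Integrable h) : Continuous (𝓕 h) :=
  VectorFourier.fourierIntegral_continuous Real.continuous_fourierChar
    (by fun_prop : Continuous fun p : ℝ × ℝ => innerₗ ℝ p.1 p.2) hh

theorem integral_schwartz_smul_fourier (u : 𝓢(ℝ, ℂ)) {h : ℝ → ℂ} (hh : Integrable h) :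
    ∫ x, u x • 𝓕 h x = ∫ x, (𝓕 u) x • h x := by
  rw [SchwartzMap.fourier_coe, integral_fourier_smul_eq u.integrable hh]

/-- The Fourier transform of a square integrable function agrees with its `L²` transform. -/
theorem eLpNorm_fourier_of_memLp {h : ℝ → ℂ} (hh : Integrable h) (h2 : MemLp h 2) :
    eLpNorm (𝓕 h) 2 volume = eLpNorm h 2 volume := by
  have hk : (𝓕 (h2.toLp h) : Lp ℂ 2 (volume : Measure ℝ)) =ᵐ[volume] 𝓕 h := by
    refine ae_eq_of_integral_schwartz_smul_eq
      ((Lp.memLp _).locallyIntegrable (by norm_num)) (continuous_fourier hh).locallyIntegrable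
      fun u => ?_
    have := congrArg (fun T => T u) (Lp.fourier_toTemperedDistribution_eq (h2.toLp h))
    simp only [TemperedDistribution.fourier_apply, Lp.toTemperedDistribution_apply] at this
    rw [← this, integral_schwartz_smul_fourier u hh]
    refine integral_congr_ae ?_
    filter_upwards [h2.coeFn_toLp] with x hx
    rw [hx]
  rw [← eLpNorm_congr_ae hk, ← eLpNorm_congr_ae h2.coeFn_toLp, ← Lp.enorm_def, ← Lp.enorm_def,
    ← ofReal_norm, ← ofReal_norm, Lp.norm_fourier_eq]

/-- The `L²` inverse transform of `𝓕 h` and `h` itself have the same pairings with Schwartz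
functions, so they agree almost everywhere. -/
theorem memLp_of_memLp_fourier {h : ℝ → ℂ} (hh : Integrable h) (h2 : MemLp (𝓕 h) 2) :
    MemLp h 2 := by
  have hk : (𝓕⁻ (h2.toLp (𝓕 h)) : Lp ℂ 2 (volume : Measure ℝ)) =ᵐ[volume] h := by
    refine ae_eq_of_integral_schwartz_smul_eq
      ((Lp.memLp _).locallyIntegrable (by norm_num)) hh.locallyIntegrable fun u => ?_
    have := congrArg (fun T => T u) (Lp.fourierInv_toTemperedDistribution_eq (h2.toLp (𝓕 h)))
    simp only [TemperedDistribution.fourierInv_apply, Lp.toTemperedDistribution_apply] at this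
    rw [← this]
    have e : ∫ x, (𝓕⁻ u) x • (h2.toLp (𝓕 h)) x = ∫ x, (𝓕⁻ u) x • 𝓕 h x := by
      refine integral_congr_ae ?_
      filter_upwards [h2.coeFn_toLp] with x hx
      rw [hx]
    rw [e, integral_schwartz_smul_fourier _ hh, fourier_fourierInv_eq]
  exact (memLp_congr_ae hk).1 (Lp.memLp _)

/-- Plancherel's identity in `[0, ∞]` for integrable functions. -/
theorem eLpNorm_fourier {h : ℝ → ℂ} (hh : Integrable h) :
    eLpNorm (𝓕 h) 2 volume = eLpNorm h 2 volume := by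
  by_cases h2 : MemLp h 2
  · exact eLpNorm_fourier_of_memLp hh h2
  · have h3 : ¬ MemLp (𝓕 h) 2 := fun H => h2 (memLp_of_memLp_fourier hh H)
    have e1 : eLpNorm h 2 volume = ⊤ := by
      by_contra H
      exact h2 ⟨hh.aestronglyMeasurable, lt_top_iff_ne_top.2 H⟩
    have e2 : eLpNorm (𝓕 h) 2 volume = ⊤ := by
      by_contra H
      exact h3 ⟨(continuous_fourier hh).aestronglyMeasurable, lt_top_iff_ne_top.2 H⟩
    rw [e1, e2]

end FourierL2

/-! ### Oscillating integrals and change of variables. -/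

theorem eLpNorm_two_sq {α F : Type*} [MeasurableSpace α] [NormedAddCommGroup F] (μ : Measure α)
    (f : α → F) : eLpNorm f 2 μ ^ 2 = ∫⁻ x, ‖f x‖ₑ ^ 2 ∂μ := by
  have := eLpNorm_nnreal_pow_eq_lintegral (μ := μ) (f := f) (p := 2) (by norm_num)
  simpa using! this

theorem eLpNorm_two_eq_mul_of_lintegral {α β F G : Type*} [MeasurableSpace α] [MeasurableSpace β]
    [NormedAddCommGroup F] [NormedAddCommGroup G] {μ : Measure α} {ν : Measure β}
    {f : α → F} {g : β → G} {c : ℝ≥0∞}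
    (h : ∫⁻ x, ‖f x‖ₑ ^ 2 ∂μ = c ^ 2 * ∫⁻ x, ‖g x‖ₑ ^ 2 ∂ν) :
    eLpNorm f 2 μ = c * eLpNorm g 2 ν := by
  rw [← eLpNorm_two_sq, ← eLpNorm_two_sq, ← mul_pow] at h
  exact (ENNReal.pow_right_strictMono two_ne_zero).injective h

theorem lintegral_comp_mul_left (f : ℝ → ℝ≥0∞) {c : ℝ} (hc : c ≠ 0) :
    ∫⁻ t, f (c * t) = ENNReal.ofReal |c⁻¹| * ∫⁻ t, f t := by
  rw [← smul_eq_mul, ← lintegral_smul_measure, ← Real.map_volume_mul_left hc]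
  exact ((Homeomorph.mulLeft₀ c hc).measurableEmbedding.lintegral_map f).symm

theorem eLpNorm_integral_exp_mul {h : ℝ → ℂ} (hh : Integrable h) :
    eLpNorm (fun t : ℝ => ∫ m, Complex.exp (Complex.I * t * (m : ℝ)) * h m) 2 volume
      = ENNReal.ofReal √(2 * Real.pi) * eLpNorm h 2 volume := by
  have hpi := Real.pi_pos
  have e : ∀ t : ℝ, ∫ m, Complex.exp (Complex.I * t * (m : ℝ)) * h m
      -- The kernel of `𝓕` is `e^{-2πi m ξ}`, so `ξ = -t/(2π)`; rescaling the squared norm then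
      -- costs the factor `2π`.
      = FourierTransform.fourier h (-(2 * Real.pi)⁻¹ * t) := by
    intro t
    rw [Real.fourier_eq']
    refine integral_congr_ae (Filter.Eventually.of_forall fun m => ?_)
    simp only [smul_eq_mul]
    congr 2
    simp only [Real.inner_apply]
    push_cast
    have : (Real.pi : ℂ) ≠ 0 := by exact_mod_cast hpi.ne'
    field_simp
  simp_rw [e]
  rw [← eLpNorm_fourier hh]
  refine eLpNorm_two_eq_mul_of_lintegral ?_
  rw [lintegral_comp_mul_left (fun t => ‖FourierTransform.fourier h t‖ₑ ^ 2)
    (by simp [hpi.ne']), ← ENNReal.ofReal_pow (by positivity), Real.sq_sqrt (by positivity)]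
  congr 2
  rw [inv_neg, inv_inv, abs_neg, abs_of_pos (by positivity)]

/-- Plancherel's identity for an oscillating integral with an injective phase `a`. -/
theorem eLpNorm_setIntegral_exp_phase_mul {S : Set ℝ} (hS : MeasurableSet S) {a : ℝ → ℝ}
    {a' : ℝ → ℝ} (ha : ∀ l ∈ S, HasDerivAt a (a' l) l) (ha' : ∀ l ∈ S, 0 < a' l)
    (hinj : InjOn a S) {G : ℝ → ℂ} (hG : IntegrableOn G S) :
    eLpNorm (fun t : ℝ => ∫ l in S, Complex.exp (Complex.I * t * (a l : ℝ)) * G l) 2 volume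
      = ENNReal.ofReal √(2 * Real.pi) *
        eLpNorm (fun l => ((√(a' l))⁻¹ : ℝ) • G l) 2 (volume.restrict S) := by
  have hd : ∀ l ∈ S, HasDerivWithinAt a (a' l) S l := fun l hl => (ha l hl).hasDerivWithinAt
  set b := Function.invFunOn a S
  have hb : ∀ l ∈ S, b (a l) = l := fun l hl => hinj.leftInvOn_invFunOn hl
  -- The density of the image measure: dividing by `a'` cancels the Jacobian of `m = a(l)`.
  set k : ℝ → ℂ := fun m => (a' (b m))⁻¹ • G (b m)
  have him : MeasurableSet (a '' S) := hS.image_of_continuousOn_injOn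
    (fun l hl => (ha l hl).continuousAt.continuousWithinAt) hinj
  have hk : IntegrableOn k (a '' S) := by
    rw [integrableOn_image_iff_integrableOn_abs_deriv_smul hS hd hinj]
    refine hG.congr_fun (fun l hl => ?_) hS
    simp only [k, hb l hl, abs_of_pos (ha' l hl), smul_smul, mul_inv_cancel₀ (ha' l hl).ne',
      one_smul]
  have e : ∀ t : ℝ, ∫ l in S, Complex.exp (Complex.I * t * (a l : ℝ)) * G l
      = ∫ m, Complex.exp (Complex.I * t * (m : ℝ)) * (a '' S).indicator k m := by
    intro t
    have e1 : ∀ m : ℝ, Complex.exp (Complex.I * t * (m : ℝ)) * (a '' S).indicator k m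
        = (a '' S).indicator (fun m : ℝ => Complex.exp (Complex.I * t * (m : ℝ)) * k m) m := by
      intro m
      by_cases hm : m ∈ a '' S <;> simp [hm]
    simp_rw [e1]
    rw [integral_indicator him, integral_image_eq_integral_abs_deriv_smul hS hd hinj]
    refine setIntegral_congr_fun hS fun l hl => ?_
    simp only [k, hb l hl, abs_of_pos (ha' l hl)]
    rw [mul_smul_comm, smul_smul, mul_inv_cancel₀ (ha' l hl).ne', one_smul]
  simp_rw [e]
  rw [eLpNorm_integral_exp_mul (hk.integrable_indicator him)]
  congr 1
  rw [eLpNorm_indicator_eq_eLpNorm_restrict him]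
  rw [← one_mul (eLpNorm _ 2 (volume.restrict S))]
  refine eLpNorm_two_eq_mul_of_lintegral ?_
  rw [one_pow, one_mul, lintegral_image_eq_lintegral_abs_deriv_mul hS hd hinj]
  refine setLIntegral_congr_fun hS fun l hl => ?_
  have hp := ha' l hl
  simp only [k, hb l hl, abs_of_pos hp, enorm_smul, mul_pow, ← mul_assoc]
  congr 1
  rw [Real.enorm_of_nonneg (by positivity), Real.enorm_of_nonneg (by positivity),
    ← ENNReal.ofReal_pow (by positivity), ← ENNReal.ofReal_pow (by positivity),
    ← ENNReal.ofReal_mul hp.le, inv_pow, inv_pow, Real.sq_sqrt hp.le]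
  congr 1
  field_simp

/-! ### Functional calculus and spectral densities. -/

namespace ProjectionValuedMeasure

variable {ℋ : Type*} [NormedAddCommGroup ℋ] [InnerProductSpace ℂ ℋ] [CompleteSpace ℋ]
variable (E : ProjectionValuedMeasure ℋ)

theorem inner_proj_left {s : Set ℝ} (hs : MeasurableSet s) (y z : ℋ) :
    inner ℂ (E.proj s y) z = inner ℂ y (E.proj s z) := by
  have := (E.isStarProjection_proj s hs).isSelfAdjoint
  rw [ContinuousLinearMap.isSelfAdjoint_iff_isSymmetric] at this
  exact this y z

theorem proj_proj {s t : Set ℝ} (hs : MeasurableSet s) (ht : MeasurableSet t) (x : ℋ) :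
    E.proj s (E.proj t x) = E.proj (s ∩ t) x := by
  rw [E.proj_inter s t hs ht]; rfl

theorem apply_of_memLp {x : ℋ} {g : ℝ → ℂ} (hg : MemLp g 2 (E.measure x)) :
    E.apply g x = E.integralL2 x (hg.toLp g) := by
  rw [apply, dif_pos hg]

theorem memLp_indicator_one (x : ℋ) {s : Set ℝ} (hs : MeasurableSet s) :
    MemLp (s.indicator fun _ => (1 : ℂ)) 2 (E.measure x) :=
  memLp_indicator_const 2 hs 1 (Or.inr (measure_ne_top _ _))

theorem apply_indicator_one (x : ℋ) {s : Set ℝ} (hs : MeasurableSet s) :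
    E.apply (s.indicator fun _ => (1 : ℂ)) x = E.proj s x := by
  rw [E.apply_of_memLp (E.memLp_indicator_one x hs), ← E.integralL2_indicator x hs]
  rfl

theorem norm_apply_sq {x : ℋ} {g : ℝ → ℂ} (hg : MemLp g 2 (E.measure x)) :
    ENNReal.ofReal (‖E.apply g x‖ ^ 2) = ∫⁻ l, ‖g l‖ₑ ^ 2 ∂E.measure x := by
  rw [E.apply_of_memLp hg, E.norm_integralL2, Lp.norm_toLp,
    ENNReal.ofReal_pow ENNReal.toReal_nonneg, ENNReal.ofReal_toReal hg.2.ne]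
  simpa using! eLpNorm_nnreal_pow_eq_lintegral (μ := E.measure x) (f := g) (p := 2) (by norm_num)

/-- The functionals `g ↦ (g(H)x, ψ)` are given by square integrable densities. -/
theorem exists_memLp_inner_apply (x ψ : ℋ) :
    ∃ h : ℝ → ℂ, MemLp h 2 (E.measure x) ∧ ∀ g, MemLp g 2 (E.measure x) →
      inner ℂ ψ (E.apply g x) = ∫ l, h l * g l ∂E.measure x := by
  let Λ : StrongDual ℂ (Lp ℂ 2 (E.measure x)) := (innerSL ℂ ψ).comp (E.integralL2 x)
  let v := (InnerProductSpace.toDual ℂ (Lp ℂ 2 (E.measure x))).symm Λ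
  refine ⟨fun l => star (v l), (Lp.memLp v).star, fun g hg => ?_⟩
  have h1 : inner ℂ v (hg.toLp g) = Λ (hg.toLp g) := InnerProductSpace.toDual_symm_apply
  rw [L2.inner_def] at h1
  rw [E.apply_of_memLp hg]
  refine (h1.symm.trans (integral_congr_ae ?_))
  filter_upwards [hg.coeFn_toLp] with l hl
  rw [hl]
  simp [mul_comm]

/-- Moving `E(s)` onto the test vector `ψ` multiplies the density of `ψ` by `1_s`, as integration
over Borel sets shows. -/
theorem proj_apply_eq {x : ℋ} {g : ℝ → ℂ} (hg : MemLp g 2 (E.measure x)) {s : Set ℝ}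
    (hs : MeasurableSet s) : E.proj s (E.apply g x) = E.apply (s.indicator g) x := by
  refine ext_inner_left ℂ fun ψ => ?_
  rw [← E.inner_proj_left hs]
  obtain ⟨h, hh, H⟩ := E.exists_memLp_inner_apply x ψ
  obtain ⟨k, hk, K⟩ := E.exists_memLp_inner_apply x (E.proj s ψ)
  have key : k =ᵐ[E.measure x] s.indicator h := by
    refine Integrable.ae_eq_of_forall_setIntegral_eq _ _ (hk.integrable (by norm_num))
      ((hh.integrable (by norm_num)).indicator hs) fun t ht _ => ?_
    have e1 := K _ (E.memLp_indicator_one x ht)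
    have e2 := H _ (E.memLp_indicator_one x (hs.inter ht))
    rw [E.apply_indicator_one x ht, E.inner_proj_left hs, E.proj_proj hs ht,
      ← E.apply_indicator_one x (hs.inter ht), e2] at e1
    have e3 : ∀ (f : ℝ → ℂ) (u : Set ℝ), (fun l => f l * u.indicator (fun _ => (1 : ℂ)) l)
        = u.indicator f := by
      intro f u
      ext l
      by_cases hl : l ∈ u <;> simp [hl]
    rw [e3, e3, integral_indicator ht, integral_indicator (hs.inter ht)] at e1
    rw [setIntegral_indicator hs, ← e1, inter_comm]
  rw [K g hg, H _ (hg.indicator hs)]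
  refine integral_congr_ae ?_
  filter_upwards [key] with l hl
  rw [hl]
  by_cases hls : l ∈ s <;> simp [hls]

/-- The measure of `e(H)x` is `|e|² dμ_x`. Thus unimodular functions of `H` preserve both absolute
continuity and the domain of `σ(H)`. -/
theorem measure_apply_of_norm_eq_one {x : ℋ} {e : ℝ → ℂ} (he : Measurable e)
    (h1 : ∀ l, ‖e l‖ = 1) : E.measure (E.apply e x) = E.measure x := by
  have hm : MemLp e 2 (E.measure x) :=
    MemLp.of_bound he.aestronglyMeasurable 1 (Filter.Eventually.of_forall fun l => (h1 l).le)
  ext s hs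
  rw [E.measure_apply _ hs, E.proj_apply_eq hm hs, E.norm_apply_sq (hm.indicator hs),
    ← lintegral_indicator_one hs]
  refine lintegral_congr fun l => ?_
  have : ‖e l‖ₑ = 1 := by rw [← ofReal_norm, h1, ENNReal.ofReal_one]
  by_cases hl : l ∈ s <;> simp [hl, this]

/-- The density relative to `μ_x` is multiplied by `dμ_x/dλ`. -/
theorem exists_density {x : ℋ} (hx : x ∈ E.acSubspace) (ψ : ℋ) :
    ∃ ρ : ℝ → ℂ, ∀ g, MemLp g 2 (E.measure x) →
      Integrable (fun l => ρ l * g l) ∧ inner ℂ ψ (E.apply g x) = ∫ l, ρ l * g l := by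
  have hx' : E.measure x ≪ volume := hx
  obtain ⟨h, hh, H⟩ := E.exists_memLp_inner_apply x ψ
  refine ⟨fun l => ((E.measure x).rnDeriv volume l).toReal • h l, fun g hg => ?_⟩
  have hi : Integrable (fun l => h l * g l) (E.measure x) := hh.integrable_mul hg
  simp only [smul_mul_assoc]
  exact ⟨(integrable_rnDeriv_smul_iff hx').2 hi, by rw [H g hg, integral_rnDeriv_smul hx']⟩

theorem exists_integrable_density {x : ℋ} (hx : x ∈ E.acSubspace) (ψ : ℋ) :
    ∃ ρ : ℝ → ℂ, Integrable ρ ∧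
      (∀ s, MeasurableSet s → inner ℂ ψ (E.proj s x) = ∫ l in s, ρ l) ∧
      ∀ g, MemLp g 2 (E.measure x) →
        Integrable (fun l => ρ l * g l) ∧ inner ℂ ψ (E.apply g x) = ∫ l, ρ l * g l := by
  obtain ⟨ρ, hρ⟩ := E.exists_density hx ψ
  have e3 : ∀ u : Set ℝ, (fun l => ρ l * u.indicator (fun _ => (1 : ℂ)) l) = u.indicator ρ := by
    intro u
    ext l
    by_cases hl : l ∈ u <;> simp [hl]
  refine ⟨ρ, ?_, fun s hs => ?_, hρ⟩
  · have := (hρ _ (E.memLp_indicator_one x MeasurableSet.univ)).1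
    rwa [e3, indicator_univ] at this
  · have := (hρ _ (E.memLp_indicator_one x hs)).2
    rwa [e3, integral_indicator hs, E.apply_indicator_one x hs] at this

/-- An integrable density is determined almost everywhere by its integrals over Borel sets, so any
such `ρ` serves. -/
theorem inner_apply_eq_integral {x : ℋ} (hx : x ∈ E.acSubspace) {ψ : ℋ} {ρ : ℝ → ℂ}
    (hρ : Integrable ρ) (h : ∀ s, MeasurableSet s → inner ℂ ψ (E.proj s x) = ∫ l in s, ρ l)
    {g : ℝ → ℂ} (hg : MemLp g 2 (E.measure x)) :
    Integrable (fun l => ρ l * g l) ∧ inner ℂ ψ (E.apply g x) = ∫ l, ρ l * g l := by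
  obtain ⟨r, hr, hr1, hr2⟩ := E.exists_integrable_density hx ψ
  have e : r =ᵐ[volume] ρ := by
    refine Integrable.ae_eq_of_forall_setIntegral_eq _ _ hr hρ fun s hs _ => ?_
    rw [← hr1 s hs, h s hs]
  have e' : (fun l => r l * g l) =ᵐ[volume] fun l => ρ l * g l := by
    filter_upwards [e] with l hl
    rw [hl]
  rw [← integrable_congr e', ← integral_congr_ae e']
  exact hr2 g hg

/-- The vector `e(H)x` is again absolutely continuous, with density `ρ e` against `ψ`, so the
single-operator formula applies to it. -/
theorem inner_apply_apply_eq_integral {x : ℋ} (hx : x ∈ E.acSubspace) {ψ : ℋ} {ρ : ℝ → ℂ}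
    (hρ : Integrable ρ) (h : ∀ s, MeasurableSet s → inner ℂ ψ (E.proj s x) = ∫ l in s, ρ l)
    {e : ℝ → ℂ} (he : Measurable e) (h1 : ∀ l, ‖e l‖ = 1)
    {g : ℝ → ℂ} (hg : MemLp g 2 (E.measure x)) :
    inner ℂ ψ (E.apply g (E.apply e x)) = ∫ l, ρ l * e l * g l := by
  have hm : MemLp e 2 (E.measure x) :=
    MemLp.of_bound he.aestronglyMeasurable 1 (Filter.Eventually.of_forall fun l => (h1 l).le)
  have hμ := E.measure_apply_of_norm_eq_one (x := x) he h1
  have hac : E.apply e x ∈ E.acSubspace := by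
    change E.measure _ ≪ volume
    rw [hμ]
    exact hx
  refine (E.inner_apply_eq_integral hac (E.inner_apply_eq_integral hx hρ h hm).1
    (fun s hs => ?_) (hμ.symm ▸ hg)).2
  rw [E.proj_apply_eq hm hs, (E.inner_apply_eq_integral hx hρ h (hm.indicator hs)).2,
    ← integral_indicator hs]
  refine integral_congr_ae (Filter.Eventually.of_forall fun l => ?_)
  by_cases hl : l ∈ s <;> simp [hl]

theorem proj_mem_acSubspace {x : ℋ} (hx : x ∈ E.acSubspace) {s : Set ℝ} (hs : MeasurableSet s) :
    E.proj s x ∈ E.acSubspace := by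
  have hx' : E.measure x ≪ volume := hx
  change E.measure _ ≪ volume
  rw [measure_absolutelyContinuous_iff] at hx' ⊢
  intro t ht h0
  rw [E.proj_proj ht hs]
  exact hx' _ (ht.inter hs) (measure_mono_null inter_subset_left h0)

theorem Pac_mem (x : ℋ) : E.Pac x ∈ E.acSubspace :=
  E.acSubspace.starProjection_apply_mem x

/-- The self-adjoint `E(s)` leaves the absolutely continuous subspace invariant, hence also its
orthogonal complement. -/
theorem Pac_proj (x : ℋ) {s : Set ℝ} (hs : MeasurableSet s) :
    E.Pac (E.proj s x) = E.proj s (E.Pac x) := by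
  refine Submodule.eq_starProjection_of_mem_of_inner_eq_zero
    (E.proj_mem_acSubspace (E.Pac_mem x) hs) fun w hw => ?_
  rw [← map_sub, E.inner_proj_left hs]
  exact Submodule.starProjection_inner_eq_zero x _ (E.proj_mem_acSubspace hw hs)

theorem ae_eq_density_of_hasDerivAt {x ψ : ℋ} {ρ : ℝ → ℂ} (hρ : Integrable ρ)
    (h : ∀ s, MeasurableSet s → inner ℂ ψ (E.proj s x) = ∫ l in s, ρ l)
    {J : Set ℝ} {k : ℝ → ℂ}
    (hk : ∀ l ∈ J, HasDerivAt (fun m => inner ℂ ψ (E.proj (Iio m) x)) (k l) l) :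
    ∀ᵐ l, l ∈ J → ρ l = k l := by
  filter_upwards [LocallyIntegrable.ae_hasDerivAt_integral hρ.locallyIntegrable] with l hl hlJ
  -- The base point 0 is arbitrary, and the endpoint `m` carries no Lebesgue mass.
  have e : (fun m => inner ℂ ψ (E.proj (Iio m) x))
      = fun m => (∫ t in Iic 0, ρ t) + ∫ t in (0 : ℝ)..m, ρ t := by
    ext m
    rw [h _ measurableSet_Iio, ← integral_Iic_eq_integral_Iio,
      ← intervalIntegral.integral_Iic_sub_Iic hρ.integrableOn hρ.integrableOn]
    ring
  have h2 := hk l hlJ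
  rw [e] at h2
  exact ((hl 0).const_add _).unique h2

end ProjectionValuedMeasure

/-! ### Parseval's identity in the antidual. -/

section Parseval

variable {X : Type*} [NormedAddCommGroup X] [InnerProductSpace ℂ X]

theorem AntiDual.exists_riesz [CompleteSpace X] (u : AntiDual X) :
    ∃ r : X, ‖r‖ = ‖u‖ ∧ ∀ g, u g = inner ℂ g r := by
  let v : StrongDual ℂ X := (starL ℂ : ℂ ≃L⋆[ℂ] ℂ).toContinuousLinearMap.comp u
  refine ⟨(InnerProductSpace.toDual ℂ X).symm v, ?_, fun g => ?_⟩
  · rw [LinearIsometryEquiv.norm_map]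
    exact ContinuousLinearMap.opNorm_ext _ _ fun g => by simp [v]
  · have h : inner ℂ ((InnerProductSpace.toDual ℂ X).symm v) g = v g :=
      InnerProductSpace.toDual_symm_apply
    rw [← inner_conj_symm, h]
    simp [v]

theorem HilbertBasis.enorm_sq_eq_tsum {κ : Type*} (b : HilbertBasis κ ℂ X) (r : X) :
    ‖r‖ₑ ^ 2 = ∑' i, ‖inner ℂ (b i) r‖ₑ ^ 2 := by
  have h := Complex.reCLM.hasSum (b.hasSum_inner_mul_inner r r)
  have e : ∀ i, Complex.reCLM (inner ℂ r (b i) * inner ℂ (b i) r) = ‖inner ℂ (b i) r‖ ^ 2 := by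
    intro i
    rw [← inner_conj_symm r (b i), Complex.conj_mul']
    simp [← Complex.ofReal_pow]
  have e2 : Complex.reCLM (inner ℂ r r) = ‖r‖ ^ 2 := by
    rw [inner_self_eq_norm_sq_to_K]
    simp [← Complex.ofReal_pow]
  simp only [e, e2] at h
  have h' := congrArg ENNReal.ofReal h.tsum_eq
  rw [ENNReal.ofReal_tsum_of_nonneg (fun _ => by positivity) h.summable] at h'
  simp only [ENNReal.ofReal_pow (norm_nonneg _), ofReal_norm] at h'
  exact h'.symm

/-- Parseval's identity for all functionals vanishing on the common kernel of countably many given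
ones, with respect to one countable orthonormal set. -/
theorem AntiDual.exists_countable_parseval [CompleteSpace X] {D : Set (AntiDual X)} (hD : D.Countable) :
    ∃ s : Set X, s.Countable ∧ ∀ u : AntiDual X,
      (∀ g, (∀ d ∈ D, d g = 0) → u g = 0) → ‖u‖ₑ ^ 2 = ∑' g : s, ‖u g‖ₑ ^ 2 := by
  -- Adding 0 makes the set nonempty, so that a sequence enumerates it.
  obtain ⟨d, hd⟩ := (hD.insert 0).exists_eq_range (insert_nonempty _ _)
  choose r hr using fun n => AntiDual.exists_riesz (d n)
  let e := InnerProductSpace.gramSchmidtNormed ℂ r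
  have ho := InnerProductSpace.gramSchmidtNormed_orthonormal' (𝕜 := ℂ) r
  obtain ⟨w, b, hsw, hb⟩ := ho.toSubtypeRange.exists_hilbertBasis_extension
  set s : Set X := range fun i : {i | InnerProductSpace.gramSchmidtNormed ℂ r i ≠ 0} =>
    InnerProductSpace.gramSchmidtNormed ℂ r i
  refine ⟨s, countable_range _, fun u hu => ?_⟩
  -- Basis vectors outside `s` are orthogonal to the span of all `r n`, so every functional in `D`
  -- kills them, and therefore so does `u`.
  have hw : ∀ g ∈ w, g ∉ s → u g = 0 := by
    intro g hgw hgs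
    refine hu g fun v hv => ?_
    have hv' : v ∈ range d := hd ▸ mem_insert_of_mem _ hv
    obtain ⟨n, rfl⟩ := hv'
    rw [(hr n).2]
    have hn : r n ∈ Submodule.span ℂ (range e) := by
      rw [InnerProductSpace.span_gramSchmidtNormed_range, InnerProductSpace.span_gramSchmidt]
      exact Submodule.subset_span ⟨n, rfl⟩
    refine Submodule.span_induction (p := fun x _ => inner ℂ g x = 0) ?_ (inner_zero_right _)
      (fun x y _ _ hx hy => by rw [inner_add_right, hx, hy, add_zero])
      (fun c x _ hx => by rw [inner_smul_right, hx, mul_zero]) hn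
    rintro x ⟨i, rfl⟩
    by_cases hi : e i = 0
    · rw [hi, inner_zero_right]
    · have his : e i ∈ s := ⟨⟨i, hi⟩, rfl⟩
      have := b.orthonormal.2 (i := ⟨g, hgw⟩) (j := ⟨e i, hsw his⟩)
        (fun h => hgs (by
          have hge : g = e i := congrArg Subtype.val h
          rw [hge]
          exact his))
      simpa [hb] using this
  obtain ⟨q, hq, hq'⟩ := AntiDual.exists_riesz u
  have h1 : ‖u‖ₑ = ‖q‖ₑ := by rw [← ofReal_norm, ← ofReal_norm, hq]
  rw [h1, b.enorm_sq_eq_tsum]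
  simp only [hb, ← hq']
  rw [tsum_subtype w fun g => ‖u g‖ₑ ^ 2, tsum_subtype s fun g => ‖u g‖ₑ ^ 2]
  refine tsum_congr fun g => ?_
  by_cases hgs : g ∈ s
  · rw [indicator_of_mem (hsw hgs), indicator_of_mem hgs]
  · rw [indicator_of_notMem hgs]
    by_cases hgw : g ∈ w
    · simp [indicator_of_mem hgw, hw g hgw hgs]
    · rw [indicator_of_notMem hgw]

end Parseval

/-! ### Integral formula for the evolution. -/

section SpectralEvolution

variable {ℋ : Type*} [NormedAddCommGroup ℋ] [InnerProductSpace ℂ ℋ] [CompleteSpace ℋ]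

theorem measurable_indicator_of_continuousOn_sdiff_finite {J N : Set ℝ} (hJ : IsOpen J)
    (hN : N.Finite) {a : ℝ → ℝ} (ha : ContinuousOn a (J \ N)) : Measurable (J.indicator a) := by
  have hS : MeasurableSet (J \ N) := hJ.measurableSet.diff hN.measurableSet
  have h : Measurable ((J \ N).indicator a) := by
    classical
    rw [← piecewise_eq_indicator]
    exact ha.measurable_piecewise continuousOn_const hS
  refine h.measurable_of_countable_ne (hN.countable.mono fun l hl => ?_)
  by_contra hlN
  refine hl ?_
  by_cases hlJ : l ∈ J <;> simp [hlJ, hlN]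

/-- Dominated convergence; this supplies the measurability in `t` that Tonelli requires. -/
theorem continuous_integral_exp_mul {μ : Measure ℝ} {a : ℝ → ℝ} (ha : AEMeasurable a μ)
    {G : ℝ → ℂ} (hG : Integrable G μ) :
    Continuous fun t : ℝ => ∫ l, Complex.exp (Complex.I * t * (a l : ℝ)) * G l ∂μ := by
  refine continuous_of_dominated (bound := fun l => ‖G l‖) (fun t => ?_) (fun t => ?_) hG.norm
    (Filter.Eventually.of_forall fun l => by fun_prop)
  · exact AEMeasurable.aestronglyMeasurable (by fun_prop) |>.mul hG.aestronglyMeasurable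
  · refine Filter.Eventually.of_forall fun l => ?_
    rw [norm_mul, mul_assoc, mul_comm Complex.I, ← Complex.ofReal_mul,
      Complex.norm_exp_ofReal_mul_I, one_mul]

/-- Matrix elements of `σ(H) e^{it a(H)} P_ac E(J)` as oscillating integrals. -/
theorem inner_spectralEvolution (E : ProjectionValuedMeasure ℋ) {J : Set ℝ}
    (hJ : MeasurableSet J) {σ a : ℝ → ℝ} (ha : Measurable (J.indicator a)) {φ ψ : ℋ} {k : ℝ → ℂ}
    (hk : ∀ l ∈ J, HasDerivAt (fun m => inner ℂ ψ (E.proj (Iio m) (E.Pac φ))) (k l) l)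
    (hφ : E.Pac (E.proj J φ) ∈ E.domain (fun l => ((J.indicator σ l : ℝ) : ℂ))) :
    IntegrableOn (fun l => (σ l : ℂ) * k l) J ∧ ∀ t : ℝ,
      inner ℂ ψ (spectralEvolution E J σ a t φ)
        = ∫ l in J, Complex.exp (Complex.I * t * (a l : ℝ)) * ((σ l : ℂ) * k l) := by
  obtain ⟨ρ, hρ, hρs, -⟩ := E.exists_integrable_density (E.Pac_mem φ) ψ
  have hae := E.ae_eq_density_of_hasDerivAt hρ hρs hk
  have hind : J.indicator ρ =ᵐ[volume] J.indicator k := by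
    filter_upwards [hae] with l hl
    by_cases hlJ : l ∈ J <;> simp [hlJ, hl]
  have hki : Integrable (J.indicator k) := (integrable_congr hind).1 (hρ.indicator hJ)
  have hx : E.Pac (E.proj J φ) ∈ E.acSubspace := E.Pac_mem _
  -- `P_ac` commutes with `E(J)`, so inserting `E(J)` only cuts the density down to `J`.
  have hden : ∀ s, MeasurableSet s →
      inner ℂ ψ (E.proj s (E.Pac (E.proj J φ))) = ∫ l in s, J.indicator k l := by
    intro s hs
    rw [E.Pac_proj φ hJ, E.proj_proj hs hJ, hρs _ (hs.inter hJ), ← setIntegral_indicator hJ]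
    exact integral_congr_ae (ae_restrict_of_ae hind)
  constructor
  · rw [← integrable_indicator_iff hJ]
    refine (E.inner_apply_eq_integral hx hki hden hφ).1.congr
      (Filter.Eventually.of_forall fun l => ?_)
    by_cases hl : l ∈ J <;> simp [hl, mul_comm]
  · intro t
    rw [spectralEvolution, E.inner_apply_apply_eq_integral hx hki hden (by fun_prop)
      (fun l => ?_) hφ, ← integral_indicator hJ]
    · refine integral_congr_ae (Filter.Eventually.of_forall fun l => ?_)
      by_cases hl : l ∈ J
      · simp only [indicator_of_mem hl]
        ring
      · simp [hl]
    · rw [mul_assoc, mul_comm, ← Complex.ofReal_mul]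
      exact Complex.norm_exp_ofReal_mul_I _

end SpectralEvolution

/-! ### The scalar and vector-valued identities. -/

theorem mainTheorem3
    {ℋ : Type*} [NormedAddCommGroup ℋ] [InnerProductSpace ℂ ℋ] [CompleteSpace ℋ]
    {X : Type*} [NormedAddCommGroup X] [NormedSpace ℂ X]
    -- the self-adjoint operator and its spectral measure
    (H : ℋ →ₗ.[ℂ] ℋ) (hH : IsSelfAdjoint H)
    (E : ProjectionValuedMeasure ℋ) (hE : E.IsSpectralMeasureOf H)
    -- the densely and continuously embedded subspace
    (ι : X →L[ℂ] ℋ) (hι : Function.Injective ι) (hιd : DenseRange ι)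
    -- the weak spectral derivative
    (J : Set ℝ) (hJ : IsOpen J) (A : ℝ → X →L[ℂ] AntiDual X)
    (hA : ∀ l ∈ J, ∀ f g : X,
      HasDerivAt (fun m => inner ℂ (ι g) (E.proj (Iio m) (E.Pac (ι f)))) (A l f g) l)
    (hAc : ∀ f g : X, ContinuousOn (fun l => A l f g) J)
    -- the functions
    (σ a : ℝ → ℝ) (hσ : ContinuousOn σ J)
    (N : Set ℝ) (hN : N.Finite) (hNJ : N ⊆ J)
    (ha : ContDiffOn ℝ 1 a (J \ N)) (ha' : ∀ l ∈ J \ N, 0 < deriv a l)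
    (hinj : InjOn a (J \ N))
    -- the vector, with `P_ac E(J) φ` in the domain of `σ(H)`
    (φ : X)
    (hφ : E.Pac (E.proj J (ι φ)) ∈ E.domain (fun l => ((J.indicator σ l : ℝ) : ℂ))) :
    (∀ ψ : X,
      eLpNorm (fun t : ℝ => inner ℂ (ι ψ) (spectralEvolution E J σ a t (ι φ))) 2 volume
        = ENNReal.ofReal (√(2 * Real.pi)) *
          eLpNorm (fun l : ℝ => ((σ l / √(deriv a l) : ℝ) : ℂ) * A l φ ψ) 2
            (volume.restrict J)) ∧
    (CompleteSpace X → InnerProductSpaceable X →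
      eLpNorm (fun t : ℝ => toAntiDual ι (spectralEvolution E J σ a t (ι φ))) 2 volume
        = ENNReal.ofReal (√(2 * Real.pi)) *
          eLpNorm (fun l : ℝ => ((σ l / √(deriv a l) : ℝ) : ℂ) • A l φ) 2
            (volume.restrict J)) := by
  have hSm : MeasurableSet (J \ N) := hJ.measurableSet.diff hN.measurableSet
  have hSo : IsOpen (J \ N) := hJ.sdiff hN.isClosed
  have hae : volume.restrict (J \ N) = (volume.restrict J : Measure ℝ) :=
    Measure.restrict_congr_set (sdiff_null_ae_eq_self (hN.measure_zero volume))
  have hder : ∀ l ∈ J \ N, HasDerivAt a (deriv a l) l := fun l hl =>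
    ((ha.differentiableOn one_ne_zero).differentiableAt (hSo.mem_nhds hl)).hasDerivAt
  have ham : Measurable (J.indicator a) :=
    measurable_indicator_of_continuousOn_sdiff_finite hJ hN ha.continuousOn
  have hev := fun ψ : X => inner_spectralEvolution E hJ.measurableSet ham
    (fun l hl => hA l hl φ ψ) hφ
  have part1 : ∀ ψ : X,
      eLpNorm (fun t : ℝ => inner ℂ (ι ψ) (spectralEvolution E J σ a t (ι φ))) 2 volume
        = ENNReal.ofReal (√(2 * Real.pi)) *
          eLpNorm (fun l : ℝ => ((σ l / √(deriv a l) : ℝ) : ℂ) * A l φ ψ) 2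
            (volume.restrict J) := by
    intro ψ
    obtain ⟨hi, he⟩ := hev ψ
    simp_rw [he]
    rw [← hae, eLpNorm_setIntegral_exp_phase_mul hSm hder ha' hinj (hi.mono_set sdiff_subset)]
    congr 2
    ext l
    rw [Complex.real_smul]
    push_cast
    ring
  refine ⟨part1, fun hX hXi => ?_⟩
  -- The parallelogram law yields an inner product inducing the given norm.
  let _ : InnerProductSpace ℂ X := InnerProductSpace.ofNorm ℂ hXi.parallelogram_identity
  obtain ⟨D, hDc, hDd⟩ := TopologicalSpace.exists_countable_dense J
  obtain ⟨s, hs, hsum⟩ :=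
    AntiDual.exists_countable_parseval (hDc.image fun l : J => A l φ)
  have hzero : ∀ g, (∀ d ∈ (fun l : J => A l φ) '' D, d g = 0) → ∀ l ∈ J, A l φ g = 0 := by
    intro g hg l hl
    have hc : Continuous fun l : J => A l φ g := (hAc φ g).domRestrict
    exact congrFun (hc.ext_on hDd continuous_const fun m hm => hg _ ⟨m, hm, rfl⟩) ⟨l, hl⟩
  have : Countable s := hs.to_subtype
  have hpt : ∀ (ψ : X) (h : ℋ), toAntiDual ι h ψ = inner ℂ (ι ψ) h := fun ψ h => rfl
  have hm1 : ∀ ψ : X, AEMeasurable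
      (fun t : ℝ => ‖toAntiDual ι (spectralEvolution E J σ a t (ι φ)) ψ‖ₑ ^ 2) := by
    intro ψ
    obtain ⟨hi, he⟩ := hev ψ
    simp_rw [hpt, he]
    have hc := continuous_integral_exp_mul ((aemeasurable_indicator_iff hJ.measurableSet).1 ham.aemeasurable) hi
    exact hc.enorm.measurable.aemeasurable.pow_const 2
  have hm2 : ∀ ψ : X, AEMeasurable
      (fun l : ℝ => ‖(((σ l / √(deriv a l) : ℝ) : ℂ) • A l φ) ψ‖ₑ ^ 2) (volume.restrict J) := by
    intro ψ
    have h1 := (hAc φ ψ).aemeasurable (μ := volume) hJ.measurableSet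
    have h2 := hσ.aemeasurable (μ := volume) hJ.measurableSet
    have h3 : AEMeasurable (deriv a) (volume.restrict J) := (measurable_deriv a).aemeasurable
    simp only [smul_apply]
    fun_prop
  refine eLpNorm_two_eq_mul_of_lintegral ?_
  have h1 : ∀ t : ℝ, ‖toAntiDual ι (spectralEvolution E J σ a t (ι φ))‖ₑ ^ 2
      = ∑' g : s, ‖toAntiDual ι (spectralEvolution E J σ a t (ι φ)) g‖ₑ ^ 2 := by
    -- If every `A l φ` with `l ∈ J` kills `g`, the integrand in the formula for the evolution
    -- vanishes on `J`.
    refine fun t => hsum _ fun g hg => ?_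
    rw [hpt, (hev g).2 t]
    refine (setIntegral_congr_fun hJ.measurableSet fun l hl => ?_).trans (integral_zero _ _)
    simp [hzero g hg l hl]
  have h2 : ∫⁻ l in J, ‖((σ l / √(deriv a l) : ℝ) : ℂ) • A l φ‖ₑ ^ 2
      = ∫⁻ l in J, ∑' g : s, ‖(((σ l / √(deriv a l) : ℝ) : ℂ) • A l φ) g‖ₑ ^ 2 := by
    refine setLIntegral_congr_fun hJ.measurableSet fun l hl => hsum _ fun g hg => ?_
    simp [hzero g hg l hl]
  simp_rw [h1]
  rw [h2, lintegral_tsum fun g : s => hm1 g, lintegral_tsum fun g : s => hm2 g, ← ENNReal.tsum_mul_left]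
  refine tsum_congr fun g => ?_
  have := congrArg (· ^ 2) (part1 g)
  simp only [mul_pow, eLpNorm_two_sq] at this
  exact this
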